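/- **Setting.** Let $\Lambda\subset\mathbb R^n$ be a Borel set with a finite Borel measure $\mu_\Lambda$ (the volume measure, e.g. Lebesgue measure), let $m\le n$, and let $Q:\Lambda\to\mathcal D:=Q(\Lambda)\subset\mathbb R^m$ be Borel measurable and, at $\mu_\Lambda$-a.e. point of $\Lambda$, differentiable relative to $\Lambda$ with Jacobian of full rank $m$. Let $\mu_{\mathcal D}=Q_*\mu_\Lambda$ and, for $\ell\in\mathcal D$, let $C_\ell=Q^{-1}(\{\ell\})$ be the generalized contour. Let $(\mu_{C_\ell})_{\ell\in\mathcal D}$ be a disintegration of $\mu_\Lambda$, i.e. a measurable family of measures with $\mu_{C_\ell}$ carried by $C_\ell$ for $\mu_{\mathcal D}$-a.e. $\ell$ and $\mu_\Lambda(A)=\int_{\mathcal D}\mu_{C_\ell}(A)\,d\mu_{\mathcal D}(\ell)$ for all Borel $A\subset\Lambda$. Let $P_{\mathcal D}$ be a probability measure on $\mathcal D$, absolutely continuous with respect to $\mu_{\mathcal D}$, with density $\rho_{\mathcal D}\ge 0$. Under an Ansatz, i.e. a measurable family of probability measures $P_\ell$ on $\Lambda$, $\ell\in\mathcal D$, with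 $P_\ell$ carried by $C_\ell$ for $\mu_{\mathcal D}$-a.e. $\ell$, the solution of the stochastic inverse problem is $P_\Lambda(A)=\int_{\mathcal D}P_\ell(A)\,dP_{\mathcal D}(\ell)$. The standard Ansatz is $P_\ell=\mu_{C_\ell}/\mu_{C_\ell}(C_\ell)$ (defined for $\mu_{\mathcal D}$-a.e. $\ell$). **Samples.** Let $d_v$ be a metric on $\Lambda$ such that $d_v(\lambda,\cdot)$ is Borel for each $\lambda$. For each $N$ let $\lambda^{(1)},\dots,\lambda^{(N)}$ (which may change with $N$) be random variables in $\Lambda$ on a common probability space, with Voronoi cells $\mathcal V_j=\{\lambda\in\Lambda: d_v(\lambda^{(j)},\lambda)\le d_v(\lambda^{(i)},\lambda)\ \forall i\}$. Assume that the cells tessellate $\Lambda$: for each $N$, a.s., $\mu_\Lambda(\mathcal V_i\cap\mathcal V_j)=0$ for all $i\ne j$. For a Borel set $A$ put $A_N=\bigcup_{\lambda^{(j)}\in A}\mathcal V_j$. Assume that the sampling rule is $\mathcal B_\Lambda$-consistent: for every Borel $A\subset\Lambda$ with $\mu_\Lambda(\partial A)=0$ (boundary relative to $\Lambda$), $\mu_\Lambda(A\triangle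 A_N)\to0$ a.s. as $N\to\infty$. **Approximations.** Given a finite Borel partition $(I_i)$ of $\mathcal D$ into $M$ (possibly empty) sets, put $p_i=P_{\mathcal D}(I_i)$, $\rho_{\mathcal D,M}=\sum_i \frac{p_i}{\mu_{\mathcal D}(I_i)}\mathbf 1_{I_i}$, $V_{ij}=\mu_\Lambda(Q^{-1}(I_i)\cap\mathcal V_j)$, $P_{\Lambda,N}(\mathcal V_j)=\sum_i p_i\,V_{ij}/\sum_{k}V_{ik}$ (with $0/0=0$), and let $\tilde P_{\Lambda,N}=\sum_{j=1}^N P_{\Lambda,N}(\mathcal V_j)\,\delta_{\lambda^{(j)}}$ be the counting measure. **Theorem.** For every Borel set $A\subset\Lambda$ with $\mu_\Lambda(\partial A)=0$ there is a sequence, indexed by $M\ge1$, of Borel partitions of $\mathcal D$ into $M$ (possibly empty) intersections of $\mathcal D$ with convex sets such that $\rho_{\mathcal D,M}\to\rho_{\mathcal D}$ in $L^1(\mu_{\mathcal D})$ as $M\to\infty$ and: 1. for the standard Ansatz, almost surely $\tilde P_{\Lambda,N}(A)\to P_\Lambda(A)$ as $N,M\to\infty$ (jointly, in any manner); 2. the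 same holds for every Ansatz $(P_\ell)$ for which the measure $\int_{\mathcal D}P_\ell\,d\mu_{\mathcal D}(\ell)$ is absolutely continuous with respect to $\mu_\Lambda$, when $V_{ij}$ is replaced by the weight $\int_{\mathcal D}P_\ell(Q^{-1}(I_i)\cap\mathcal V_j)\,d\mu_{\mathcal D}(\ell)$ given by the Ansatz. -/

import Mathlib

open MeasureTheory ProbabilityTheory Filter Topology
open scoped ENNReal

noncomputable section

namespace StochInverse

/-- The quantity-of-interest map as a map from the parameter domain `Λ` onto its range
`𝒟 = q '' Λ`. The generalized contours are the fibres `qoi q Λ ⁻¹' {ℓ}`, `ℓ : 𝒟`. -/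
def qoi {n m : ℕ} (q : EuclideanSpace ℝ (Fin n) → EuclideanSpace ℝ (Fin m))
    (Λ : Set (EuclideanSpace ℝ (Fin n))) : Λ → (q '' Λ : Set (EuclideanSpace ℝ (Fin m))) :=
  fun x => ⟨q x, Set.mem_image_of_mem q x.2⟩

/-- The components of `q` are geometrically distinct at almost every point of `Λ`: `q` is
differentiable there (relative to `Λ`) with a Jacobian of full rank `m`. -/
def GeometricallyDistinct {n m : ℕ} (q : EuclideanSpace ℝ (Fin n) → EuclideanSpace ℝ (Fin m))
    (Λ : Set (EuclideanSpace ℝ (Fin n))) (μ : Measure Λ) : Prop :=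
  ∀ᵐ x : Λ ∂μ, ∃ q' : EuclideanSpace ℝ (Fin n) →L[ℝ] EuclideanSpace ℝ (Fin m),
    HasFDerivWithinAt q q' Λ x ∧ Module.finrank ℝ (LinearMap.range q'.toLinearMap) = m

section Contours

variable {X D : Type*} [MeasurableSpace X] [MeasurableSpace D]

/-- The family `κ ℓ` is carried by the contours `Q ⁻¹' {ℓ}` (for almost every `ℓ` with respect to
the push-forward volume). -/
def CarriedByContours (Q : X → D) (μ : Measure X) (κ : Kernel D X) : Prop :=
  ∀ᵐ ℓ ∂(μ.map Q), κ ℓ (Q ⁻¹' {ℓ})ᶜ = 0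

/-- Disintegration of the volume measure: a measurable family of measures `κ ℓ` on the contours
with `μ A = ∫ κ ℓ A dμ_𝒟(ℓ)`, where `μ_𝒟 = μ.map Q`. -/
structure IsVolumeDisintegration (Q : X → D) (μ : Measure X) (κ : Kernel D X) : Prop where
  carried : CarriedByContours Q μ κ
  disintegrates : ∀ A : Set X, MeasurableSet A → μ A = ∫⁻ ℓ, κ ℓ A ∂(μ.map Q)

/-- The standard Ansatz: the contour volumes divided by their total mass. -/
def standardAnsatz (κ : Kernel D X) : Kernel D X where
  toFun ℓ := (κ ℓ Set.univ)⁻¹ • κ ℓ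
  measurable' := by
    refine Measure.measurable_of_measurable_coe _ fun s hs => ?_
    simp only [Measure.smul_apply, smul_eq_mul]
    exact (κ.measurable_coe MeasurableSet.univ).inv.mul (κ.measurable_coe hs)

/-- An Ansatz: a measurable family of probability measures on the contours. -/
structure IsAnsatz (Q : X → D) (μ : Measure X) (P : Kernel D X) : Prop where
  carried : CarriedByContours Q μ P
  isProbability : ∀ ℓ, IsProbabilityMeasure (P ℓ)

/-- The solution of the stochastic inverse problem for output law `PD` under the Ansatz `P`:
`A ↦ ∫ P ℓ A dPD(ℓ)`. -/
def inverseSolution (PD : Measure D) (P : Kernel D X) : Measure X := PD.bind P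

/-- Volume disintegrations exist. -/
theorem exists_isVolumeDisintegration [StandardBorelSpace X] [Nonempty X] [MeasurableEq D]
    {Q : X → D} (hQ : Measurable Q) (μ : Measure X) [IsFiniteMeasure μ] :
    ∃ κ : Kernel D X, IsVolumeDisintegration Q μ κ := by
  have hcomp := compProd_map_condDistrib (mβ := inferInstanceAs (MeasurableSpace D)) (X := Q) (Y := id) (μ := μ) aemeasurable_id
  have key : ∀ s : Set (D × X), MeasurableSet s →
      μ ((fun a => (Q a, id a)) ⁻¹' s)
        = ∫⁻ ℓ, condDistrib id Q μ ℓ (Prod.mk ℓ ⁻¹' s) ∂(μ.map Q) := by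
    intro s hs
    rw [← Measure.compProd_apply hs, hcomp, Measure.map_apply (hQ.prodMk measurable_id) hs]
  refine ⟨condDistrib id Q μ, ?_, fun A hA => ?_⟩
  · have hs : MeasurableSet {z : D × X | Q z.2 = z.1}ᶜ :=
      (measurableSet_eq_fun (hQ.comp measurable_snd) measurable_fst).compl
    have h := key _ hs
    have h0 : μ ((fun a => (Q a, id a)) ⁻¹' {z : D × X | Q z.2 = z.1}ᶜ) = 0 := by
      simp
    rw [h0] at h
    have h1 := (lintegral_eq_zero_iff (Kernel.measurable_kernel_prodMk_left hs)).1 h.symm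
    filter_upwards [h1] with ℓ hℓ
    exact hℓ
  · have h := key (Set.univ ×ˢ A) (MeasurableSet.univ.prod hA)
    have h2 : (fun a => (Q a, id a)) ⁻¹' (Set.univ ×ˢ A) = A := by ext; simp
    rw [h2] at h
    simpa using h

end Contours

section Partition

variable {D : Type*} [MeasurableSpace D] {ι : Type*} [Fintype ι]

/-- A finite Borel partition (empty cells are allowed). -/
structure IsPartition (I : ι → Set D) : Prop where
  measurable : ∀ i, MeasurableSet (I i)
  disjoint : Pairwise fun i j => Disjoint (I i) (I j)
  cover : ⋃ i, I i = Set.univ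

/-- The normalized simple function approximation of the density of `PD` with respect to `ν`
on the partition `I`: the value on `I i` is `PD (I i) / ν (I i)` (read as `0` if `ν (I i) = 0`). -/
def simpleDensity (PD ν : Measure D) (I : ι → Set D) (ℓ : D) : ℝ :=
  ∑ i, (I i).indicator (fun _ => PD.real (I i) / ν.real (I i)) ℓ

end Partition

section Voronoi

variable {X : Type*}

/-- `d` is a metric on `X`. -/
structure IsMetric (d : X → X → ℝ) : Prop where
  eq_zero_iff : ∀ x y, d x y = 0 ↔ x = y
  symm : ∀ x y, d x y = d y x
  triangle : ∀ x y z, d x z ≤ d x y + d y z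

variable {N : ℕ}

/-- The Voronoi cell of the `j`-th of the samples `s`. -/
def voronoiCell (d : X → X → ℝ) (s : Fin N → X) (j : Fin N) : Set X :=
  {x | ∀ i, d (s j) x ≤ d (s i) x}

/-- The Voronoi coverage of `A`. -/
def voronoiCoverage (d : X → X → ℝ) (s : Fin N → X) (A : Set X) : Set X :=
  ⋃ j ∈ {j : Fin N | s j ∈ A}, voronoiCell d s j

variable [MeasurableSpace X]

/-- The cells of different samples overlap only in null sets. -/
def IsTessellation (μ : Measure X) (d : X → X → ℝ) (s : Fin N → X) : Prop :=
  Pairwise fun i j => μ (voronoiCell d s i ∩ voronoiCell d s j) = 0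

/-- A (possibly random) rule, giving samples `lam N 0 ω, …, lam N (N - 1) ω` for each `N`, is
consistent: the Voronoi coverages of every Borel set with null boundary converge to it in volume,
almost surely. -/
def IsConsistentRule [TopologicalSpace X] {Ω : Type*} [MeasurableSpace Ω] (Pr : Measure Ω)
    (μ : Measure X) (d : X → X → ℝ) (lam : (N : ℕ) → Fin N → Ω → X) : Prop :=
  ∀ A : Set X, MeasurableSet A → μ (frontier A) = 0 →
    ∀ᵐ ω ∂Pr, Tendsto (fun N => μ (symmDiff A (voronoiCoverage d (fun j => lam N j ω) A)))
      atTop (𝓝 0)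

variable {D : Type*} [MeasurableSpace D] {ι : Type*} [Fintype ι]

/-- The probability of the `j`-th Voronoi cell, `∑ i, p i * (V i j / ∑ k, V i k)`, where
`p i = PD (I i)` and `V i j` is the `w`-measure of the intersection of the region
`Q ⁻¹' (I i)` with the cell. -/
def cellProb (Q : X → D) (w : Measure X) (PD : Measure D) (I : ι → Set D)
    (d : X → X → ℝ) (s : Fin N → X) (j : Fin N) : ℝ≥0∞ :=
  ∑ i, PD (I i) * (w (Q ⁻¹' (I i) ∩ voronoiCell d s j) /
    ∑ k, w (Q ⁻¹' (I i) ∩ voronoiCell d s k))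

/-- The counting measure: a point mass at each sample, of size the probability of its cell. -/
def countingMeasure (Q : X → D) (w : Measure X) (PD : Measure D) (I : ι → Set D)
    (d : X → X → ℝ) (s : Fin N → X) : Measure X :=
  ∑ j, cellProb Q w PD I d s j • Measure.dirac (s j)

end Voronoi

end StochInverse

end

/-! Put w = ∫ P_ℓ dμ_𝒟(ℓ). As P_ℓ is a probability measure carried by its contour, w pushes forward
to μ_𝒟, and P_Λ has density ρ ∘ Q with respect to w (`inverseSolution_map`,
`inverseSolution_apply_eq_setLIntegral`). The cells cover Λ with null overlaps, so the w-weights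
satisfy ∑ₖ V_ik = μ_𝒟(I_i), and the counting measure of A is exactly the w-integral of ρ_{𝒟,M} ∘ Q
over the coverage A_N (`countingMeasure_apply`). With τ = (ρ ∘ Q) w, its distance to P_Λ(A) = τ(A)
is therefore at most ‖ρ_{𝒟,M} - ρ‖₁ + τ(A △ A_N). One term depends only on M, the other only on N,
and the latter vanishes because τ is finite and τ ≪ μ; this gives the joint limit
(`tendsto_countingMeasure`).

The partitions are cut out by more and more rational coordinate half-spaces. On them the simple
density is a conditional expectation of ρ, and Lévy's upward theorem gives L¹ convergence
(`exists_convex_partitions`). They depend neither on A nor on the Ansatz. For the standard Ansatz,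
almost every κ ℓ already has mass 1, so that w = μ. -/

namespace StochInverse

/-! ### Convex partitions and L¹ convergence of the simple densities. -/

section ConvexPartitions

variable {D : Type*}

/-- The natural number whose binary digits record to which of the first `k` sets of the sequence
`H` a point belongs. -/
noncomputable def binaryCode (H : ℕ → Set D) : ℕ → D → ℕ
  | 0, _ => 0
  | k + 1, x => 2 * binaryCode H k x + (H k).indicator (fun _ => 1) x

theorem binaryCode_succ_of_mem {H : ℕ → Set D} {k : ℕ} {x : D} (h : x ∈ H k) :
    binaryCode H (k + 1) x = 2 * binaryCode H k x + 1 := by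
  simp [binaryCode, h]

theorem binaryCode_succ_of_notMem {H : ℕ → Set D} {k : ℕ} {x : D} (h : x ∉ H k) :
    binaryCode H (k + 1) x = 2 * binaryCode H k x := by
  simp [binaryCode, h]

theorem binaryCode_lt (H : ℕ → Set D) (k : ℕ) (x : D) : binaryCode H k x < 2 ^ k := by
  induction k with
  | zero => simp [binaryCode]
  | succ k ih =>
    by_cases h : x ∈ H k
    · rw [binaryCode_succ_of_mem h, pow_succ]; omega
    · rw [binaryCode_succ_of_notMem h, pow_succ]; omega

theorem binaryCode_eq_div_two (H : ℕ → Set D) (k : ℕ) (x : D) :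
    binaryCode H k x = binaryCode H (k + 1) x / 2 := by
  by_cases h : x ∈ H k
  · rw [binaryCode_succ_of_mem h]; omega
  · rw [binaryCode_succ_of_notMem h]; omega

theorem mem_iff_binaryCode_odd (H : ℕ → Set D) (k : ℕ) (x : D) :
    x ∈ H k ↔ binaryCode H (k + 1) x % 2 = 1 := by
  by_cases h : x ∈ H k
  · rw [binaryCode_succ_of_mem h]; simp [h]
  · rw [binaryCode_succ_of_notMem h]; simp [h]

/-- If the sets of a sequence and their complements are traces of convex sets, so are the fibres of
its binary code. -/
theorem exists_convex_binaryCode_fibre {E : Type*} [AddCommGroup E] [Module ℝ E] (S : ℕ → Set E)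
    (hS : ∀ k, Convex ℝ (S k)) (hS' : ∀ k, Convex ℝ (S k)ᶜ) (k i : ℕ) :
    Convex ℝ {x | binaryCode S k x = i} := by
  induction k generalizing i with
  | zero =>
    by_cases h : i = 0
    · simp [binaryCode, h, convex_univ]
    · simp [binaryCode, Ne.symm h, convex_empty]
  | succ k ih =>
    -- The last digit of `i` selects `S k` or its complement; `i / 2` encodes the earlier digits.
    rcases Nat.mod_two_eq_zero_or_one i with h | h
    · convert (ih (i / 2)).inter (hS' k) using 1
      ext x
      by_cases hx : x ∈ S k
      · simp [binaryCode_succ_of_mem hx, hx]; omega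
      · simp [binaryCode_succ_of_notMem hx, hx]; omega
    · convert (ih (i / 2)).inter (hS k) using 1
      ext x
      by_cases hx : x ∈ S k
      · simp [binaryCode_succ_of_mem hx, hx]; omega
      · simp [binaryCode_succ_of_notMem hx, hx]; omega

/-- Transports convexity of code fibres in the ambient space to traces on the range of the map. -/
theorem binaryCode_preimage {E : Type*} (g : D → E) (S : ℕ → Set E) (k : ℕ) (x : D) :
    binaryCode (fun k => g ⁻¹' S k) k x = binaryCode S k (g x) := by
  induction k with
  | zero => rfl
  | succ k ih => simp only [binaryCode, ih]; rfl

/-- Countably many half-spaces generate the Borel sets of a Euclidean space. -/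
theorem exists_halfSpaces (m : ℕ) : ∃ S : ℕ → Set (EuclideanSpace ℝ (Fin m)),
    (∀ k, Convex ℝ (S k)) ∧ (∀ k, Convex ℝ (S k)ᶜ) ∧ (∀ k, MeasurableSet (S k)) ∧
      (inferInstance : MeasurableSpace (EuclideanSpace ℝ (Fin m)))
        ≤ MeasurableSpace.generateFrom (Set.range S) := by
  -- The extra index, sent to `∅`, keeps the index type nonempty when `m = 0`.
  obtain ⟨e, he⟩ := exists_surjective_nat (Option (Fin m × ℚ))
  let T : Option (Fin m × ℚ) → Set (EuclideanSpace ℝ (Fin m)) := fun o =>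
    o.elim ∅ fun p => {x | x p.1 < (p.2 : ℝ)}
  have hlin (c : Fin m) : IsLinearMap ℝ fun x : EuclideanSpace ℝ (Fin m) => x c :=
    ⟨fun _ _ => rfl, fun _ _ => rfl⟩
  have hmeas (c : Fin m) : Measurable fun x : EuclideanSpace ℝ (Fin m) => x c := by fun_prop
  refine ⟨T ∘ e, fun k => ?_, fun k => ?_, fun k => ?_, ?_⟩
  · rcases h : e k with _ | p
    · simp [T, h, convex_empty]
    · simpa [T, h] using convex_halfSpace_lt (hlin p.1) (p.2 : ℝ)
  · rcases h : e k with _ | p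
    · simp [T, h, convex_univ]
    · simpa [T, h, Set.compl_ofPred] using convex_halfSpace_ge (hlin p.1) (p.2 : ℝ)
  · rcases h : e k with _ | p
    · simp [T, h]
    · simpa [T, h] using measurableSet_lt (hmeas p.1) measurable_const
  · have hto : Measurable fun x : Fin m → ℝ => (WithLp.toLp 2 x : EuclideanSpace ℝ (Fin m)) :=
      (PiLp.continuous_toLp 2 _).measurable
    have hcoord (c : Fin m) : Measurable[MeasurableSpace.generateFrom (Set.range (T ∘ e))]
        fun x : EuclideanSpace ℝ (Fin m) => x c := by
      rw [BorelSpace.measurable_eq (α := ℝ), Real.borel_eq_generateFrom_Iio_rat]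
      refine @measurable_generateFrom _ _ (_) _ _ fun t ht => ?_
      obtain ⟨a, rfl⟩ : ∃ a : ℚ, t = Set.Iio (a : ℝ) := by simpa [eq_comm] using ht
      obtain ⟨k, hk⟩ := he (some (c, a))
      refine MeasurableSpace.measurableSet_generateFrom ⟨k, ?_⟩
      simp only [Function.comp_apply, hk, T]
      rfl
    have hpi : Measurable[MeasurableSpace.generateFrom (Set.range (T ∘ e))]
        fun x : EuclideanSpace ℝ (Fin m) => x.ofLp :=
      @measurable_pi_lambda _ _ _ (_) _ _ hcoord
    have hid : Measurable[MeasurableSpace.generateFrom (Set.range (T ∘ e))]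
        fun x : EuclideanSpace ℝ (Fin m) => x := hto.comp hpi
    intro s hs
    exact hid hs

variable [MeasurableSpace D]

theorem measurable_binaryCode {H : ℕ → Set D} (hH : ∀ k, MeasurableSet (H k)) (k : ℕ) :
    Measurable (binaryCode H k) := by
  induction k with
  | zero => exact measurable_const
  | succ k ih => exact (ih.const_mul 2).add (measurable_const.indicator (hH k))

/-- The filtration generated by the binary codes. -/
noncomputable def binaryFiltration (H : ℕ → Set D) (hH : ∀ k, MeasurableSet (H k)) :
    Filtration ℕ (inferInstance : MeasurableSpace D) where
  seq k := MeasurableSpace.comap (binaryCode H k) ⊤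
  mono' := monotone_nat_of_le_succ fun k => by
    rintro _ ⟨t, -, rfl⟩
    -- Halving a code drops its last digit, so each code determines the preceding one.
    refine ⟨{j | j / 2 ∈ t}, trivial, ?_⟩
    ext x
    simp [binaryCode_eq_div_two H k x]
  le' k := (measurable_binaryCode hH k).comap_le

theorem generateFrom_le_iSup_binaryFiltration (H : ℕ → Set D) (hH : ∀ k, MeasurableSet (H k)) :
    MeasurableSpace.generateFrom (Set.range H) ≤ ⨆ k, binaryFiltration H hH k := by
  refine MeasurableSpace.generateFrom_le ?_
  rintro _ ⟨k, rfl⟩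
  refine le_iSup (fun k => binaryFiltration H hH k) (k + 1) _ ⟨{j | j % 2 = 1}, trivial, ?_⟩
  ext x
  exact (mem_iff_binaryCode_odd H k x).symm

theorem isPartition_fibres {ι : Type*} [Fintype ι] [MeasurableSpace ι]
    [MeasurableSingletonClass ι] {f : D → ι} (hf : Measurable f) :
    IsPartition fun i => f ⁻¹' {i} where
  measurable i := hf (measurableSet_singleton i)
  disjoint i j hij := Disjoint.preimage f (Set.disjoint_singleton.2 hij)
  cover := by ext x; simp

theorem simpleDensity_eq_of_mem {ι : Type*} [Fintype ι] {PD ν : Measure D} {I : ι → Set D}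
    (hI : IsPartition I) {i : ι} {x : D} (hx : x ∈ I i) :
    simpleDensity PD ν I x = PD.real (I i) / ν.real (I i) := by
  rw [simpleDensity, Finset.sum_eq_single i]
  · simp [hx]
  · intro j _ hj
    exact Set.indicator_of_notMem (fun h => Set.disjoint_left.1 (hI.disjoint hj) h hx) _
  · simp

theorem measurable_simpleDensity {ι : Type*} [Fintype ι] (PD ν : Measure D) {I : ι → Set D}
    (hI : IsPartition I) : Measurable (simpleDensity PD ν I) := by
  unfold simpleDensity
  exact Finset.measurable_fun_sum _ fun i _ => measurable_const.indicator (hI.measurable i)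

variable {PD ν : Measure D} {ρ : D → ℝ}

theorem integrable_density [IsFiniteMeasure PD] (hρm : Measurable ρ)
    (hρ : PD = ν.withDensity fun ℓ => ENNReal.ofReal (ρ ℓ)) (hρ0 : ∀ ℓ, 0 ≤ ρ ℓ) :
    Integrable ρ ν := by
  refine ⟨hρm.aestronglyMeasurable, ?_⟩
  rw [hasFiniteIntegral_iff_ofReal (Eventually.of_forall hρ0)]
  have h := measure_lt_top PD Set.univ
  rwa [hρ, withDensity_apply _ MeasurableSet.univ, setLIntegral_univ] at h

theorem setIntegral_density (hρm : Measurable ρ)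
    (hρ : PD = ν.withDensity fun ℓ => ENNReal.ofReal (ρ ℓ)) (hρ0 : ∀ ℓ, 0 ≤ ρ ℓ)
    {s : Set D} (hs : MeasurableSet s) : ∫ x in s, ρ x ∂ν = PD.real s := by
  rw [integral_eq_lintegral_of_nonneg_ae (Eventually.of_forall hρ0) hρm.aestronglyMeasurable,
    measureReal_def, hρ, withDensity_apply _ hs]

/-- On the fibres of a finite-valued map the simple density is a conditional expectation. -/
theorem simpleDensity_fibres_ae_eq_condExp {ι : Type*} [Fintype ι] [MeasurableSpace ι]
    [MeasurableSingletonClass ι] [IsFiniteMeasure ν] [IsFiniteMeasure PD] (hρm : Measurable ρ)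
    (hρ : PD = ν.withDensity fun ℓ => ENNReal.ofReal (ρ ℓ)) (hρ0 : ∀ ℓ, 0 ≤ ρ ℓ)
    {f : D → ι} (hf : Measurable f) :
    simpleDensity PD ν (fun i => f ⁻¹' {i})
      =ᵐ[ν] ν[ρ | MeasurableSpace.comap f inferInstance] := by
  have hI := isPartition_fibres hf
  have hac : PD ≪ ν := hρ ▸ withDensity_absolutelyContinuous _ _
  have hg : simpleDensity PD ν (fun i => f ⁻¹' {i})
      = (fun i => PD.real (f ⁻¹' {i}) / ν.real (f ⁻¹' {i})) ∘ f := by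
    ext x
    exact simpleDensity_eq_of_mem hI (i := f x) rfl
  have hint : Integrable (simpleDensity PD ν fun i => f ⁻¹' {i}) ν := by
    rw [hg]
    exact Integrable.comp_measurable Integrable.of_finite hf
  refine ae_eq_condExp_of_forall_setIntegral_eq hf.comap_le
    (integrable_density hρm hρ hρ0) (fun _ _ _ => hint.integrableOn) ?_ ?_
  · rintro _ ⟨t, ht, rfl⟩ -
    rw [setIntegral_density hρm hρ hρ0 (hf ht), hg]
    simp only [Function.comp_def]
    -- Pushed forward to the finite type, both sides become sums over `t`, compared atom by atom.
    rw [← setIntegral_map ht (f := fun i => PD.real (f ⁻¹' {i}) / ν.real (f ⁻¹' {i}))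
      (Measurable.of_discrete).aestronglyMeasurable hf.aemeasurable,
      ← integral_indicator ht, integral_fintype Integrable.of_finite,
      ← map_measureReal_apply hf ht, ← integral_indicator_one ht,
      integral_fintype Integrable.of_finite]
    refine Finset.sum_congr rfl fun i _ => ?_
    by_cases hi : i ∈ t
    · simp only [Set.indicator_of_mem hi, smul_eq_mul, Pi.one_apply, mul_one]
      rw [map_measureReal_apply hf (measurableSet_singleton i),
        map_measureReal_apply hf (measurableSet_singleton i)]
      -- On a null cell the quotient is `0` by convention, and `PD` vanishes there by absolute
      -- continuity.
      by_cases h0 : ν.real (f ⁻¹' {i}) = 0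
      · have h1 : ν (f ⁻¹' {i}) = 0 := (measureReal_eq_zero_iff).1 h0
        simp [measureReal_def, hac h1, h1]
      · field_simp
    · simp [hi]
  · rw [hg]
    refine StronglyMeasurable.aestronglyMeasurable ?_
    refine Measurable.stronglyMeasurable ?_
    exact Measurable.of_discrete.comp (comap_measurable f)

/-- The density of `PD` is the `L¹` limit of its simple densities on finite partitions by traces of
convex sets. -/
theorem exists_convex_partitions {m : ℕ} {R : Set (EuclideanSpace ℝ (Fin m))} {PD ν : Measure R}
    [IsFiniteMeasure ν] [IsFiniteMeasure PD] {ρ : R → ℝ} (hρm : Measurable ρ)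
    (hρ : PD = ν.withDensity fun ℓ => ENNReal.ofReal (ρ ℓ)) (hρ0 : ∀ ℓ, 0 ≤ ρ ℓ) :
    ∃ I : (M : ℕ) → Fin (M + 1) → Set R, (∀ M, IsPartition (I M)) ∧
      (∀ M i, ∃ K : Set (EuclideanSpace ℝ (Fin m)), Convex ℝ K ∧ I M i = Subtype.val ⁻¹' K) ∧
      Tendsto (fun M => eLpNorm (fun ℓ => simpleDensity PD ν (I M) ℓ - ρ ℓ) 1 ν) atTop (𝓝 0) := by
  obtain ⟨S, hS, hS', hSm, hSgen⟩ := exists_halfSpaces m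
  let H : ℕ → Set R := fun k => Subtype.val ⁻¹' S k
  have hH k : MeasurableSet (H k) := measurable_subtype_coe (hSm k)
  -- The codes of the first log₂(M + 1) half-spaces fit into `M + 1` labels; the surplus labels give
  -- empty cells.
  have hlog (M : ℕ) : 2 ^ Nat.log 2 (M + 1) ≤ M + 1 := Nat.pow_log_le_self 2 (by omega)
  let F : (M : ℕ) → R → Fin (M + 1) := fun M x =>
    ⟨binaryCode H (Nat.log 2 (M + 1)) x, (binaryCode_lt H _ x).trans_le (hlog M)⟩
  have hF M : Measurable (F M) := by
    refine measurable_to_countable' fun i => ?_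
    convert measurable_binaryCode hH (Nat.log 2 (M + 1)) (measurableSet_singleton (i : ℕ)) using 1
    ext x
    simp [F, Fin.ext_iff]
  have hcomap M : MeasurableSpace.comap (F M) inferInstance
      = binaryFiltration H hH (Nat.log 2 (M + 1)) := by
    apply le_antisymm
    · rintro _ ⟨t, -, rfl⟩
      refine ⟨Fin.val '' t, trivial, ?_⟩
      ext x
      exact ⟨fun ⟨a, ha, h⟩ => Set.mem_preimage.2 ((Fin.ext h : a = F M x) ▸ ha), fun h => ⟨_, h, rfl⟩⟩
    · rintro _ ⟨t, -, rfl⟩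
      exact ⟨Fin.val ⁻¹' t, MeasurableSet.of_discrete, rfl⟩
  refine ⟨fun M i => F M ⁻¹' {i}, fun M => isPartition_fibres (hF M), fun M i =>
    ⟨_, exists_convex_binaryCode_fibre S hS hS' (Nat.log 2 (M + 1)) i, ?_⟩, ?_⟩
  · ext x
    simp only [F, Set.mem_preimage, Set.mem_singleton_iff, Fin.ext_iff, Set.mem_ofPred_eq,
      ← binaryCode_preimage, H]
  · have hgen : (inferInstance : MeasurableSpace R) ≤ ⨆ k, binaryFiltration H hH k := by
      refine le_trans ?_ (generateFrom_le_iSup_binaryFiltration H hH)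
      refine (MeasurableSpace.comap_mono hSgen).trans ?_
      rw [MeasurableSpace.comap_generateFrom]
      refine MeasurableSpace.generateFrom_mono ?_
      rintro _ ⟨_, ⟨k, rfl⟩, rfl⟩
      exact ⟨k, rfl⟩
    -- Lévy's upward theorem: the filtration generates the Borel sets, so the limit is `ρ` itself.
    have hlim := (integrable_density hρm hρ hρ0).tendsto_eLpNorm_condExp
      (ℱ := binaryFiltration H hH) (hρm.mono hgen le_rfl).stronglyMeasurable
    have hlogtop : Tendsto (fun M => Nat.log 2 (M + 1)) atTop atTop :=
      tendsto_atTop.2 fun b => (eventually_ge_atTop (2 ^ b)).mono fun M hM =>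
        Nat.le_log_of_pow_le (by norm_num) (by omega)
    refine (hlim.comp hlogtop).congr fun M => eLpNorm_congr_ae ?_
    have h := simpleDensity_fibres_ae_eq_condExp hρm hρ hρ0 (hF M)
    rw [hcomap M] at h
    filter_upwards [h] with x hx
    simp [hx]

end ConvexPartitions

end StochInverse
namespace StochInverse

/-! ### Voronoi cells and the counting measure as an integral. -/

section Cells

variable {X : Type*} {N : ℕ}

theorem voronoiCoverage_univ (d : X → X → ℝ) (s : Fin (N + 1) → X) :
    voronoiCoverage d s Set.univ = Set.univ := by
  refine Set.eq_univ_of_forall fun x => ?_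
  obtain ⟨j, hj⟩ := Finite.exists_min fun j => d (s j) x
  simpa [voronoiCoverage] using ⟨j, hj⟩

variable [MeasurableSpace X]

theorem measurableSet_voronoiCell {d : X → X → ℝ} (hd : ∀ x, Measurable (d x)) (s : Fin N → X)
    (j : Fin N) : MeasurableSet (voronoiCell d s j) := by
  have : voronoiCell d s j = ⋂ i, {x | d (s j) x ≤ d (s i) x} := by ext; simp [voronoiCell]
  rw [this]
  exact MeasurableSet.iInter fun i => measurableSet_le (hd _) (hd _)

theorem measurableSet_voronoiCoverage {d : X → X → ℝ} (hd : ∀ x, Measurable (d x))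
    (s : Fin N → X) (A : Set X) : MeasurableSet (voronoiCoverage d s A) :=
  MeasurableSet.iUnion fun j => MeasurableSet.iUnion fun _ => measurableSet_voronoiCell hd s j

open Classical in
theorem sum_measure_inter_voronoiCell {d : X → X → ℝ} (hd : ∀ x, Measurable (d x))
    {s : Fin N → X} {w : Measure X} (ht : IsTessellation w d s) (A : Set X) {B : Set X}
    (hB : MeasurableSet B) :
    ∑ j with s j ∈ A, w (B ∩ voronoiCell d s j) = w (B ∩ voronoiCoverage d s A) := by
  have : B ∩ voronoiCoverage d s A
      = ⋃ j ∈ Finset.univ.filter fun j => s j ∈ A, B ∩ voronoiCell d s j := by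
    ext x; simp [voronoiCoverage]
  rw [this, measure_biUnion_finset₀]
  · intro i _ j _ hij
    exact measure_mono_null (Set.inter_subset_inter Set.inter_subset_right
      Set.inter_subset_right) (ht hij)
  · exact fun j _ => (hB.inter (measurableSet_voronoiCell hd s j)).nullMeasurableSet

variable {D : Type*} [MeasurableSpace D] {ι : Type*} [Fintype ι]

/-- The counting measure of `A` is the mass of the Voronoi coverage of `A` under the measure with
density the simple density on contours. -/
theorem countingMeasure_apply {Q : X → D} (hQ : Measurable Q) {w : Measure X} [IsFiniteMeasure w]
    {PD : Measure D} [IsFiniteMeasure PD] (hPD : PD ≪ w.map Q) {I : ι → Set D}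
    (hI : IsPartition I) {d : X → X → ℝ} (hd : ∀ x, Measurable (d x))
    {s : Fin (N + 1) → X} (ht : IsTessellation w d s) {A : Set X} (hA : MeasurableSet A) :
    countingMeasure Q w PD I d s A
      = ∫⁻ x in voronoiCoverage d s A,
          ENNReal.ofReal (simpleDensity PD (w.map Q) I (Q x)) ∂w := by
  classical
  -- With at least one sample the cells cover everything, so the denominators do not depend on the
  -- samples.
  have hden i : ∑ k, w (Q ⁻¹' (I i) ∩ voronoiCell d s k) = w.map Q (I i) := by
    have h := sum_measure_inter_voronoiCell hd ht Set.univ (hQ (hI.measurable i))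
    rw [voronoiCoverage_univ, Set.inter_univ] at h
    rw [Measure.map_apply hQ (hI.measurable i), ← h]
    simp
  have hcover : voronoiCoverage d s A = ⋃ i, Q ⁻¹' (I i) ∩ voronoiCoverage d s A := by
    rw [← Set.iUnion_inter, ← Set.preimage_iUnion, hI.cover]; simp
  have hpiece i : ∫⁻ x in Q ⁻¹' (I i) ∩ voronoiCoverage d s A,
      ENNReal.ofReal (simpleDensity PD (w.map Q) I (Q x)) ∂w
        = PD (I i) * (w (Q ⁻¹' (I i) ∩ voronoiCoverage d s A) / w.map Q (I i)) := by
    rw [setLIntegral_congr_fun (g := fun _ =>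
        ENNReal.ofReal (PD.real (I i) / (w.map Q).real (I i)))
      ((hQ (hI.measurable i)).inter (measurableSet_voronoiCoverage hd s A))
      (fun x hx => by simp only; rw [simpleDensity_eq_of_mem hI hx.1]), setLIntegral_const]
    -- The conventions for division by zero agree here, as `PD (I i) = 0` too.
    by_cases h0 : w.map Q (I i) = 0
    · simp [hPD h0, measureReal_def]
    · rw [ENNReal.ofReal_div_of_pos (by
        rw [measureReal_def]; exact ENNReal.toReal_pos h0 (measure_ne_top _ _)),
        ofReal_measureReal, ofReal_measureReal]
      simp only [div_eq_mul_inv]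
      ring
  conv_rhs => rw [hcover]
  rw [lintegral_iUnion, tsum_fintype]
  · simp only [hpiece]
    simp only [countingMeasure, cellProb, hden, Measure.finsetSum_apply, Measure.smul_apply,
      smul_eq_mul, Measure.dirac_apply' _ hA]
    simp only [← sum_measure_inter_voronoiCell hd ht A (hQ (hI.measurable _)),
      Finset.sum_mul, div_eq_mul_inv, Finset.mul_sum]
    rw [Finset.sum_comm]
    refine Finset.sum_congr rfl fun i _ => ?_
    rw [Finset.sum_filter]
    refine Finset.sum_congr rfl fun j _ => ?_
    by_cases hj : s j ∈ A <;> simp [hj]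
  · exact fun i => (hQ (hI.measurable i)).inter (measurableSet_voronoiCoverage hd s A)
  · exact fun i j hij => ((hI.disjoint hij).preimage Q).mono Set.inter_subset_left
      Set.inter_subset_left

end Cells

/-! ### Error estimates, solutions as densities, and the joint limit. -/

section Limits

variable {X D : Type*} [MeasurableSpace X] [MeasurableSpace D]

/-- Absolute continuity of the integral of the Radon–Nikodym derivative, integrable because `τ` is
finite. -/
theorem tendsto_measure_of_absolutelyContinuous {ι : Type*} {l : Filter ι} {τ μ : Measure X}
    [IsFiniteMeasure τ] [SigmaFinite μ] (h : τ ≪ μ) {s : ι → Set X}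
    (hs : ∀ i, MeasurableSet (s i)) (hl : Tendsto (fun i => μ (s i)) l (𝓝 0)) :
    Tendsto (fun i => τ (s i)) l (𝓝 0) := by
  have := tendsto_setLIntegral_zero (Measure.lintegral_rnDeriv_lt_top τ μ).ne hl
  refine this.congr fun i => ?_
  rw [← withDensity_apply _ (hs i), Measure.withDensity_rnDeriv_eq _ _ h]

/-- The error term does not involve `s`, so the estimate is uniform over all Voronoi coverages. -/
theorem lintegral_ofReal_le_add_eLpNorm {w : Measure X} {Q : X → D} (hQ : Measurable Q)
    {f g : D → ℝ} (hf : Measurable f) (hg : Measurable g) (s : Set X) :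
    ∫⁻ x in s, ENNReal.ofReal (f (Q x)) ∂w
      ≤ ∫⁻ x in s, ENNReal.ofReal (g (Q x)) ∂w + eLpNorm (fun ℓ => f ℓ - g ℓ) 1 (w.map Q) := by
  rw [eLpNorm_one_eq_lintegral_enorm, lintegral_map (f := fun ℓ => ‖f ℓ - g ℓ‖ₑ) (hf.sub hg).enorm hQ]
  calc ∫⁻ x in s, ENNReal.ofReal (f (Q x)) ∂w
      ≤ ∫⁻ x in s, (ENNReal.ofReal (g (Q x)) + ‖f (Q x) - g (Q x)‖ₑ) ∂w := by
        refine lintegral_mono fun x => ?_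
        rw [Real.enorm_eq_ofReal_abs]
        refine le_trans (ENNReal.ofReal_le_ofReal ?_) ENNReal.ofReal_add_le
        linarith [le_abs_self (f (Q x) - g (Q x))]
    _ = ∫⁻ x in s, ENNReal.ofReal (g (Q x)) ∂w + ∫⁻ x in s, ‖f (Q x) - g (Q x)‖ₑ ∂w :=
        lintegral_add_left (hg.comp hQ).ennreal_ofReal _
    _ ≤ _ := add_le_add_right (setLIntegral_le_lintegral _ _) _

theorem measure_le_add_symmDiff (τ : Measure X) (s t : Set X) :
    τ s ≤ τ t + τ (symmDiff s t) := by
  refine (measure_mono fun x hx => ?_).trans (measure_union_le t (symmDiff s t))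
  by_cases h : x ∈ t
  · exact Or.inl h
  · exact Or.inr (Or.inl ⟨hx, h⟩)

/-- The contour carrying `P` lies inside `Q ⁻¹' B` or is disjoint from it. -/
theorem measure_preimage_of_carried {Q : X → D} (hQ : Measurable Q) {P : Measure X} {ℓ : D}
    {B : Set D} (hB : MeasurableSet B) (hℓ : P (Q ⁻¹' {ℓ})ᶜ = 0) :
    P (Q ⁻¹' B) = B.indicator (fun _ => P Set.univ) ℓ := by
  by_cases hm : ℓ ∈ B
  · have h0 : P (Q ⁻¹' B)ᶜ = 0 := measure_mono_null
      (Set.compl_subset_compl.2 (Set.preimage_mono (Set.singleton_subset_iff.2 hm))) hℓ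
    have := measure_add_measure_compl (μ := P) (hQ hB)
    rw [h0, add_zero] at this
    simp [hm, this]
  · rw [Set.indicator_of_notMem hm]
    refine measure_mono_null (Set.disjoint_left.1 (Disjoint.preimage Q ?_)) hℓ
    exact Set.disjoint_singleton_right.2 hm

theorem inverseSolution_map {Q : X → D} (hQ : Measurable Q) {μ : Measure X}
    {P : Kernel D X} (hc : CarriedByContours Q μ P) (h1 : ∀ᵐ ℓ ∂μ.map Q, P ℓ Set.univ = 1) :
    (inverseSolution (μ.map Q) P).map Q = μ.map Q := by
  ext B hB
  rw [Measure.map_apply hQ hB, inverseSolution, Measure.bind_apply (hQ hB) P.aemeasurable,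
    ← lintegral_indicator_one hB]
  refine lintegral_congr_ae ?_
  filter_upwards [hc, h1] with ℓ hℓ hℓ1
  rw [measure_preimage_of_carried hQ hB hℓ]
  simp only [hℓ1]
  rfl

/-- On the contour of `ℓ` the function `f ∘ Q` is constantly `f ℓ`, so a density on the range can be
moved inside the contour integrals. -/
theorem inverseSolution_apply_eq_setLIntegral {Q : X → D} (hQ : Measurable Q) {μ : Measure X}
    {PD : Measure D} {f : D → ℝ≥0∞} (hf : Measurable f)
    (hPD : PD = (μ.map Q).withDensity f) {P : Kernel D X} (hc : CarriedByContours Q μ P)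
    {A : Set X} (hA : MeasurableSet A) :
    inverseSolution PD P A = ∫⁻ x in A, f (Q x) ∂inverseSolution (μ.map Q) P := by
  rw [inverseSolution, Measure.bind_apply hA P.aemeasurable, hPD,
    lintegral_withDensity_eq_lintegral_mul _ hf (P.measurable_coe hA), inverseSolution,
    ← lintegral_indicator hA,
    Measure.lintegral_bind (f := A.indicator fun x => f (Q x)) P.aemeasurable
      ((hf.comp hQ).indicator hA).aemeasurable]
  refine lintegral_congr_ae ?_
  filter_upwards [hc] with ℓ hℓ
  rw [lintegral_indicator hA]
  have hae : ∀ᵐ x ∂(P ℓ).restrict A, f (Q x) = f ℓ := by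
    refine ae_restrict_of_ae ?_
    filter_upwards [show ∀ᵐ x ∂P ℓ, x ∈ Q ⁻¹' {ℓ} from hℓ] with x hx
    exact congrArg f hx
  rw [lintegral_congr_ae hae]
  simp

theorem tendsto_countingMeasure {Q : X → D} (hQ : Measurable Q) {w : Measure X}
    [IsFiniteMeasure w] {PD : Measure D} [IsFiniteMeasure PD] {ρ : D → ℝ} (hρm : Measurable ρ)
    (hρ : PD = (w.map Q).withDensity fun ℓ => ENNReal.ofReal (ρ ℓ))
    {I : (M : ℕ) → Fin (M + 1) → Set D} (hI : ∀ M, IsPartition (I M))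
    (hIρ : Tendsto (fun M => eLpNorm (fun ℓ => simpleDensity PD (w.map Q) (I M) ℓ - ρ ℓ) 1
      (w.map Q)) atTop (𝓝 0))
    {μ : Measure X} [IsFiniteMeasure μ] (hw : w ≪ μ) {d : X → X → ℝ}
    (hd : ∀ x, Measurable (d x)) {s : (N : ℕ) → Fin N → X}
    (ht : ∀ N, IsTessellation μ d (s N)) {A : Set X} (hA : MeasurableSet A)
    (hs : Tendsto (fun N => μ (symmDiff A (voronoiCoverage d (s N) A))) atTop (𝓝 0)) :
    Tendsto (fun p : ℕ × ℕ => countingMeasure Q w PD (I p.2) d (s p.1) A) (atTop ×ˢ atTop)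
      (𝓝 (∫⁻ x in A, ENNReal.ofReal (ρ (Q x)) ∂w)) := by
  set τ := w.withDensity fun x => ENNReal.ofReal (ρ (Q x))
  have hac : PD ≪ w.map Q := hρ ▸ withDensity_absolutelyContinuous _ _
  have hfin : ∫⁻ x, ENNReal.ofReal (ρ (Q x)) ∂w ≠ ∞ := by
    rw [← lintegral_map (f := fun ℓ => ENNReal.ofReal (ρ ℓ)) hρm.ennreal_ofReal hQ,
      ← setLIntegral_univ, ← withDensity_apply _ MeasurableSet.univ, ← hρ]
    exact measure_ne_top _ _
  have : IsFiniteMeasure τ := isFiniteMeasure_withDensity hfin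
  have hcov N : MeasurableSet (voronoiCoverage d (s N) A) :=
    measurableSet_voronoiCoverage hd _ A
  have hτ : τ ≪ μ := (withDensity_absolutelyContinuous _ _).trans hw
  have he := tendsto_measure_of_absolutelyContinuous hτ (fun N => hA.symmDiff (hcov N)) hs
  set e := fun N => τ (symmDiff A (voronoiCoverage d (s N) A))
  set δ := fun M => eLpNorm (fun ℓ => simpleDensity PD (w.map Q) (I M) ℓ - ρ ℓ) 1
    (w.map Q)
  have herr : Tendsto (fun p : ℕ × ℕ => e p.1 + δ p.2) (atTop ×ˢ atTop) (𝓝 0) := by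
    simpa using (he.comp tendsto_fst).add (hIρ.comp tendsto_snd)
  rw [← withDensity_apply _ hA]
  have hcount : ∀ N M, 1 ≤ N → countingMeasure Q w PD (I M) d (s N) A
      = ∫⁻ x in voronoiCoverage d (s N) A,
        ENNReal.ofReal (simpleDensity PD (w.map Q) (I M) (Q x)) ∂w := by
    intro N M hN
    obtain ⟨N, rfl⟩ : ∃ k, N = k + 1 := ⟨N - 1, by omega⟩
    exact countingMeasure_apply hQ hac (hI M) hd (fun i j hij => hw (ht _ hij)) hA
  -- Without samples there are no cells and the integral formula is unavailable; this affects only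
  -- `N = 0`.
  have hN : ∀ᶠ p : ℕ × ℕ in atTop ×ˢ atTop, 1 ≤ p.1 :=
    tendsto_fst.eventually (eventually_ge_atTop 1)
  -- Subtraction is truncated; finiteness of `τ A` makes it continuous here.
  have hlow : Tendsto (fun p : ℕ × ℕ => τ A - (e p.1 + δ p.2)) (atTop ×ˢ atTop) (𝓝 (τ A)) := by
    simpa using ENNReal.Tendsto.sub (tendsto_const_nhds (x := τ A)) herr
      (Or.inl (measure_ne_top τ A))
  have hup : Tendsto (fun p : ℕ × ℕ => τ A + (e p.1 + δ p.2)) (atTop ×ˢ atTop) (𝓝 (τ A)) := by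
    simpa using (tendsto_const_nhds (x := τ A)).add herr
  refine tendsto_of_tendsto_of_tendsto_of_le_of_le' hlow hup ?_ ?_
  · filter_upwards [hN] with p hp
    rw [tsub_le_iff_right, hcount _ _ hp]
    refine (measure_le_add_symmDiff τ A (voronoiCoverage d (s p.1) A)).trans ?_
    have h := lintegral_ofReal_le_add_eLpNorm (w := w) hQ hρm
      (measurable_simpleDensity PD (w.map Q) (hI p.2)) (voronoiCoverage d (s p.1) A)
    rw [show (fun ℓ => ρ ℓ - simpleDensity PD (w.map Q) (I p.2) ℓ)
      = ρ - simpleDensity PD (w.map Q) (I p.2) from rfl, eLpNorm_sub_comm] at h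
    rw [withDensity_apply _ (hcov _), add_comm (e p.1), ← add_assoc]
    gcongr
    exact h
  · filter_upwards [hN] with p hp
    rw [hcount _ _ hp]
    refine (lintegral_ofReal_le_add_eLpNorm (w := w) hQ
      (measurable_simpleDensity PD (w.map Q) (hI p.2)) hρm
      (voronoiCoverage d (s p.1) A)).trans ?_
    rw [← withDensity_apply _ (hcov _), ← add_assoc]
    gcongr
    have h := measure_le_add_symmDiff τ (voronoiCoverage d (s p.1) A) A
    rwa [symmDiff_comm] at h

/-- Disintegrating μ(Q⁻¹(B)) shows that `κ ℓ Set.univ` and `1` have the same integral over every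
Borel set `B`. Hence the normalization in the standard Ansatz changes nothing almost everywhere. -/
theorem IsVolumeDisintegration.ae_univ_eq_one {Q : X → D} (hQ : Measurable Q) {μ : Measure X}
    [IsFiniteMeasure μ] {κ : Kernel D X} (hκ : IsVolumeDisintegration Q μ κ) :
    ∀ᵐ ℓ ∂μ.map Q, κ ℓ Set.univ = 1 := by
  refine ae_eq_of_forall_setLIntegral_eq_of_sigmaFinite (κ.measurable_coe MeasurableSet.univ)
    measurable_const fun B hB _ => ?_
  rw [setLIntegral_one, Measure.map_apply hQ hB, hκ.disintegrates _ (hQ hB),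
    ← lintegral_indicator hB]
  refine lintegral_congr_ae ?_
  filter_upwards [hκ.carried] with ℓ hℓ
  rw [measure_preimage_of_carried hQ hB hℓ, Set.indicator, Set.indicator]

theorem IsVolumeDisintegration.inverseSolution_eq {Q : X → D} {μ : Measure X} {κ : Kernel D X}
    (hκ : IsVolumeDisintegration Q μ κ) : inverseSolution (μ.map Q) κ = μ := by
  ext A hA
  rw [inverseSolution, Measure.bind_apply hA κ.aemeasurable, hκ.disintegrates A hA]

theorem IsVolumeDisintegration.inverseSolution_standardAnsatz {Q : X → D} (hQ : Measurable Q)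
    {μ : Measure X} [IsFiniteMeasure μ] {κ : Kernel D X} (hκ : IsVolumeDisintegration Q μ κ)
    {PD : Measure D} (hPD : PD ≪ μ.map Q) :
    inverseSolution PD (standardAnsatz κ) = inverseSolution PD κ := by
  refine Measure.bind_congr_right ?_
  filter_upwards [hPD.ae_le (hκ.ae_univ_eq_one hQ)] with ℓ hℓ
  change (κ ℓ Set.univ)⁻¹ • κ ℓ = κ ℓ
  simp [hℓ]

end Limits

end StochInverse

/-! ### The main theorem. -/

open StochInverse in
theorem mainTheorem1 {n m : ℕ} (hmn : m ≤ n)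
    (Λ : Set (EuclideanSpace ℝ (Fin n))) (hΛ : MeasurableSet Λ)
    (μ : Measure Λ) [IsFiniteMeasure μ]
    (q : EuclideanSpace ℝ (Fin n) → EuclideanSpace ℝ (Fin m))
    (hq : Measurable (qoi q Λ)) (hGD : GeometricallyDistinct q Λ μ)
    -- the output law and its density with respect to the push-forward volume
    (PD : Measure (q '' Λ : Set (EuclideanSpace ℝ (Fin m)))) [IsProbabilityMeasure PD]
    (ρ : (q '' Λ : Set (EuclideanSpace ℝ (Fin m))) → ℝ) (hρm : Measurable ρ)
    (hρ0 : ∀ ℓ, 0 ≤ ρ ℓ)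
    (hρ : PD = (μ.map (qoi q Λ)).withDensity fun ℓ => ENNReal.ofReal (ρ ℓ))
    -- the contour volumes
    (κ : Kernel (q '' Λ : Set (EuclideanSpace ℝ (Fin m))) Λ)
    (hκ : IsVolumeDisintegration (qoi q Λ) μ κ)
    -- the metric of the Voronoi cells and the sampling rule
    (dv : Λ → Λ → ℝ) (hdv : IsMetric dv) (hdvm : ∀ x, Measurable (dv x))
    {Ω : Type*} [MeasurableSpace Ω] (Pr : Measure Ω) [IsProbabilityMeasure Pr]
    (lam : (N : ℕ) → Fin N → Ω → Λ) (hlam : ∀ N j, Measurable (lam N j))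
    (htess : ∀ N, ∀ᵐ ω ∂Pr, IsTessellation μ dv fun j => lam N j ω)
    (hcons : IsConsistentRule Pr μ dv lam)
    (A : Set Λ) (hA : MeasurableSet A) (hAb : μ (frontier A) = 0) :
    ∃ I : (M : ℕ) → Fin (M + 1) → Set (q '' Λ : Set (EuclideanSpace ℝ (Fin m))),
      (∀ M, IsPartition (I M)) ∧
      (∀ M i, ∃ K : Set (EuclideanSpace ℝ (Fin m)), Convex ℝ K ∧ I M i = Subtype.val ⁻¹' K) ∧
      Tendsto (fun M => eLpNorm
        (fun ℓ => simpleDensity PD (μ.map (qoi q Λ)) (I M) ℓ - ρ ℓ) 1 (μ.map (qoi q Λ)))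
        atTop (𝓝 0) ∧
      -- standard Ansatz
      (∀ᵐ ω ∂Pr, Tendsto
        (fun p : ℕ × ℕ =>
          countingMeasure (qoi q Λ) μ PD (I p.2) dv (fun j => lam p.1 j ω) A)
        (atTop ×ˢ atTop) (𝓝 (inverseSolution PD (standardAnsatz κ) A))) ∧
      -- any Ansatz that is absolutely continuous with respect to volume, with its own weighting
      (∀ P : Kernel (q '' Λ : Set (EuclideanSpace ℝ (Fin m))) Λ, IsAnsatz (qoi q Λ) μ P →
        inverseSolution (μ.map (qoi q Λ)) P ≪ μ →
        ∀ᵐ ω ∂Pr, Tendsto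
          (fun p : ℕ × ℕ => countingMeasure (qoi q Λ)
            (inverseSolution (μ.map (qoi q Λ)) P) PD (I p.2) dv (fun j => lam p.1 j ω) A)
          (atTop ×ˢ atTop) (𝓝 (inverseSolution PD P A))) := by
  have hac : PD ≪ μ.map (qoi q Λ) := hρ ▸ withDensity_absolutelyContinuous _ _
  obtain ⟨I, hI, hconv, hlim⟩ := exists_convex_partitions hρm hρ hρ0
  have key (P : Kernel (q '' Λ : Set (EuclideanSpace ℝ (Fin m))) Λ)
      (hc : CarriedByContours (qoi q Λ) μ P)
      (h1 : ∀ᵐ ℓ ∂μ.map (qoi q Λ), P ℓ Set.univ = 1)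
      (hw : inverseSolution (μ.map (qoi q Λ)) P ≪ μ) :
      ∀ᵐ ω ∂Pr, Tendsto
        (fun p : ℕ × ℕ => countingMeasure (qoi q Λ)
          (inverseSolution (μ.map (qoi q Λ)) P) PD (I p.2) dv (fun j => lam p.1 j ω) A)
        (atTop ×ˢ atTop) (𝓝 (inverseSolution PD P A)) := by
    have hmap := inverseSolution_map hq hc h1
    have : IsFiniteMeasure (inverseSolution (μ.map (qoi q Λ)) P) := by
      refine ⟨?_⟩
      rw [← Set.preimage_univ (f := qoi q Λ), ← Measure.map_apply hq MeasurableSet.univ, hmap]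
      exact measure_lt_top _ _
    filter_upwards [ae_all_iff.2 htess, hcons A hA hAb] with ω ht hs
    rw [inverseSolution_apply_eq_setLIntegral hq hρm.ennreal_ofReal hρ hc hA]
    -- The weight of the Ansatz has the same push-forward as the volume, so one sequence of
    -- partitions serves every Ansatz.
    exact tendsto_countingMeasure hq hρm (by rwa [hmap]) hI (by rwa [hmap]) hw hdvm
      (s := fun N j => lam N j ω) ht hA hs
  refine ⟨I, hI, hconv, hlim, ?_, fun P hP hw => key P hP.carried
    (Eventually.of_forall fun ℓ => (hP.isProbability ℓ).measure_univ) hw⟩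
  -- `κ` itself serves as the family, with weight μ; only its almost everywhere unit mass is needed.
  have h := key κ hκ.carried (hκ.ae_univ_eq_one hq) hκ.inverseSolution_eq.absolutelyContinuous
  rw [hκ.inverseSolution_eq] at h
  rwa [hκ.inverseSolution_standardAnsatz hq hac]
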